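/- Let $G$ be a group with a finite generating set $X$, and let $|w|$ denote the word length of $w\in G$ with respect to $X$. For a generator $g\in X$ and an integer $k\ge 0$, an element $w\in G$ is called a *seesaw word of swing $k$ with respect to $g$* if 1. $|wg|=|wg^{-1}|=|w|-1$, and $|wh^{\pm1}|\ge |w|$ for all $h\in X\smallsetminus\{g,g^{-1}\}$; 2. $|wg^{l}|=|wg^{l-1}|-1$ for all integers $1\le l\le k$, and $|wg^{m}h|\ge |wg^{m}|$ for all integers $1\le m\le k-1$ and all $h\in (X\cup X^{-1})\smallsetminus\{g\}$; 3. $|wg^{-l}|=|wg^{-l+1}|-1$ for all integers $1\le l\le k$, and $|wg^{-m}h|\ge |wg^{-m}|$ for all integers $1\le m\le k-1$ and all $h\in (X\cup X^{-1})\smallsetminus\{g^{-1}\}$. Let $F=\langle x_n,\ n\ge 0 \mid x_i^{-1}x_jx_i=x_{j+1}\text{ if } i<j\rangle$ be Thompson's group, with its standard finite generating set $\{x_0,x_1\}$. **Theorem 4.1.** $F$ contains seesaw words of arbitrarily large swing with respect to the generator $x_0$ in the generating set $\{x_0,x_1\}$: for every integer $k\ge 0$ there is $w\in F$ that is a seesaw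 word of swing $k$ with respect to $x_0$. Explicitly, for all integers $k\ge 0$, $l\ge 1$ and $m\ge 2$ with $l\ge k$ and $m\ge k$, the element $$x_0^{m-1}\,x_1\,x_{m+2l+2}\,x_{m+2l+1}^{-1}\,x_{m+2l-1}^{-1}\,x_{m+2l-3}^{-1}\cdots x_{m+3}^{-1}\,x_{m+1}^{-1}\,x_0^{-m}$$ (in which the inverted indices decrease from $m+2l+1$ to $m+1$ in steps of $2$) is a seesaw word of swing $k$ with respect to $x_0$. -/

import Mathlib

/-- The length `|w|` of `w` with respect to `X`: the least length of a word in the letters of `X`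
and their inverses that represents `w`. (It is only used when `X` generates `G`, so that such a
word exists.) -/
noncomputable def wordLength {G : Type*} [Group G] (X : Set G) (w : G) : ℕ :=
  sInf {n : ℕ | ∃ L : List G, (∀ a ∈ L, a ∈ X ∨ a⁻¹ ∈ X) ∧ L.prod = w ∧ L.length = n}

/-- `w` is a seesaw word of swing `k` with respect to the generator `g`, in the group `G` with the
finite generating set `X`. -/
structure IsSeesawWord {G : Type*} [Group G] (X : Set G) (g w : G) (k : ℕ) : Prop where
  finite : X.Finite
  generates : Subgroup.closure X = ⊤
  mem : g ∈ X
  /-- `|w g| = |w| - 1` -/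
  shorten : wordLength X (w * g) + 1 = wordLength X w
  /-- `|w g⁻¹| = |w| - 1` -/
  shorten_inv : wordLength X (w * g⁻¹) + 1 = wordLength X w
  /-- No generator other than `g` and `g⁻¹`, and no inverse of one, shortens `w`. -/
  others : ∀ h ∈ X, h ≠ g → h ≠ g⁻¹ →
    wordLength X w ≤ wordLength X (w * h) ∧ wordLength X w ≤ wordLength X (w * h⁻¹)
  /-- `|w g ^ (i + 1)| = |w g ^ i| - 1` for `0 ≤ i ≤ k - 1` -/
  forward : ∀ i : ℕ, i < k →
    wordLength X (w * g ^ (i + 1)) + 1 = wordLength X (w * g ^ i)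
  /-- For `1 ≤ i ≤ k - 1`, no generator or inverse of a generator except `g`
  shortens `w g ^ i`. -/
  forward_others : ∀ i : ℕ, 1 ≤ i → i < k → ∀ h : G, (h ∈ X ∨ h⁻¹ ∈ X) → h ≠ g →
    wordLength X (w * g ^ i) ≤ wordLength X (w * g ^ i * h)
  /-- `|w g ^ (-(i + 1))| = |w g ^ (-i)| - 1` for `0 ≤ i ≤ k - 1` -/
  backward : ∀ i : ℕ, i < k →
    wordLength X (w * g⁻¹ ^ (i + 1)) + 1 = wordLength X (w * g⁻¹ ^ i)
  /-- For `1 ≤ i ≤ k - 1`, no generator or inverse of a generator except `g⁻¹`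
  shortens `w g ^ (-i)`. -/
  backward_others : ∀ i : ℕ, 1 ≤ i → i < k → ∀ h : G, (h ∈ X ∨ h⁻¹ ∈ X) → h ≠ g⁻¹ →
    wordLength X (w * g⁻¹ ^ i) ≤ wordLength X (w * g⁻¹ ^ i * h)

/-- The relators `x_i⁻¹ x_j x_i x_{j+1}⁻¹`, for `i < j`, of Thompson's group. -/
def thompsonRels : Set (FreeGroup ℕ) :=
  {r | ∃ i j : ℕ, i < j ∧
    r = (FreeGroup.of i)⁻¹ * FreeGroup.of j * FreeGroup.of i * (FreeGroup.of (j + 1))⁻¹}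

/-- Thompson's group `F = ⟨x_n, n ≥ 0 | x_i⁻¹ x_j x_i = x_{j+1} if i < j⟩`. -/
abbrev ThompsonF : Type := PresentedGroup thompsonRels

namespace ThompsonF

/-- The generator `x_n` of the infinite presentation. -/
def x (n : ℕ) : ThompsonF := PresentedGroup.of n

/-- The standard finite generating set `{x_0, x_1}`. -/
def stdGens : Set ThompsonF := {x 0, x 1}

/-- The element
`x_0^{m-1} x_1 x_{m+2l+2} x_{m+2l+1}⁻¹ x_{m+2l-1}⁻¹ ⋯ x_{m+3}⁻¹ x_{m+1}⁻¹ x_0^{-m}`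
(for `m ≥ 1`; the inverted indices go down from `m+2l+1` to `m+1` in steps of two). -/
def seesaw (l m : ℕ) : ThompsonF :=
  x 0 ^ (m - 1) * x 1 * x (m + 2 * l + 2) *
    ((List.range (l + 1)).reverse.map fun i => (x (m + 2 * i + 1))⁻¹).prod * (x 0 ^ m)⁻¹

end ThompsonF

/-! The proof uses the forest diagrams of Belk and Brown. An element of `F` is a pair of binary
forests. The carets at leaf 0 only record a pointer: if there are `b` of them, then `b` of the trees
that begin at the leaves 1, 2, … lie to the left of the pointed tree. Right multiplication by `x 0`
or its inverse moves the pointer of the second forest by one tree; `x 1` removes a caret at the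
pointed tree, and its inverse adds one.

The size of a diagram is its number of carets plus weights of the spaces between leaves. One
generator raises it by at most one and reduction never raises it, so it bounds the word length from
below (`reducedSize_diagram_le`). The opposite inequality is not needed in general.

For the seesaw word both pointed trees begin at leaf `m + 1`, and the second forest has `l + 1`
adjacent carets from there on. Moving the second pointer to the left removes a label `left` opposite
`left` (once opposite `inner`), so a weight drops by one; this can be done `m` times. Moving it to
the right replaces `next` opposite `right` by `left`, and the weight drops from 2 to 1; this can be
done `l` times. Adding or removing a caret at the pointer raises the size by one
(`size_addCaret_seesawDiagram`, `size_removeCaret_seesawDiagram`).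

The exact lengths come from a sandwich: the diagram bounds `|w|` from below, and explicit words
(`seesaw_mul_pow`, `seesaw_mul_inv_pow`) show that the two ends of the seesaw are shorter than this
by `m` and by `l`. The triangle inequality then fixes all lengths in between. -/

namespace ThompsonF

/-! ### Forest diagrams

An element `∏ x_i ^ a_i * (∏ x_i ^ b_i)⁻¹` of Thompson's group is recorded by the list of the pairs
`(a_i, b_i)`, which describes a pair of binary forests with common leaves `0, 1, 2, …`: the numbers
`a_i` and `b_i` count the carets of the two forests whose leftmost leaf is `i`. -/

/-- A pair of forests, given by the numbers of carets with a given leftmost leaf. -/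
abbrev Diagram : Type := List (ℕ × ℕ)

/-- Puts an entry in front of a reduced diagram and cancels common carets. -/
def push : ℕ → ℕ → Diagram → Diagram
  | a + 1, b + 1, [] => push a b []
  | a + 1, b + 1, (0, 0) :: s => push a b s
  | 0, 0, [] => []
  | a, b, s => (a, b) :: s

/-- The reduced form of a diagram. -/
def reduce : Diagram → Diagram
  | [] => []
  | (a, b) :: t => push a b (reduce t)

/-- Adds to the second forest a caret that joins the roots `c` and `c + 1`. -/
def addCaret : ℕ → Diagram → Diagram
  | 0, (a, b) :: t => (a, b + 1) :: t
  -- Behind the leaf, the `b` right subtrees of its tree count as roots as well, hence `c + b`.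
  | c + 1, (a, b) :: t => (a, b) :: addCaret (c + b) t
  | 0, [] => [(0, 1)]
  | c + 1, [] => (0, 0) :: addCaret c []

/-- Removes from the second forest the caret at the root `c`, after splitting the leaf at this root
in both forests if there is no caret. -/
def removeCaret : ℕ → Diagram → Diagram
  | 0, (a, 0) :: t => (a + 1, 0) :: (0, 0) :: t
  | 0, (a, b + 1) :: t => (a, b) :: t
  | c + 1, (a, b) :: t => (a, b) :: removeCaret (c + b) t
  | 0, [] => [(1, 0)]
  | c + 1, [] => (0, 0) :: removeCaret c []

lemma push_succ_succ_push (a b : ℕ) (s : Diagram) :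
    push (a + 1) (b + 1) (push 0 0 s) = push a b s := by
  cases s <;> simp [push]

lemma push_cons_of_eq_zero {a b : ℕ} (h : a = 0 ∨ b = 0) (x : ℕ × ℕ) (s : Diagram) :
    push a b (x :: s) = (a, b) :: x :: s := by
  rcases h with rfl | rfl
  · cases b <;> simp [push]
  · cases a <;> simp [push]

lemma reduce_cons (x : ℕ × ℕ) (t : Diagram) : reduce (x :: t) = push x.1 x.2 (reduce t) := rfl

lemma reduce_push (a b : ℕ) (s : Diagram) : reduce (push a b s) = push a b (reduce s) := by
  fun_induction push a b s with
  | case1 a b ih => simpa [reduce, push] using ih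
  | case2 a b s ih => rw [ih, reduce_cons, push_succ_succ_push]
  | case3 => rfl
  | case4 => rfl

lemma reduce_reduce (t : Diagram) : reduce (reduce t) = reduce t := by
  induction t with
  | nil => rfl
  | cons x t ih => rw [reduce_cons, reduce_push, ih]

/-- Cancelling a common caret lowers `b` by one and deletes one leaf. The two effects on the count
of roots to the right balance, so the new caret lands at the same place. -/
lemma reduce_addCaret_push (c a b : ℕ) (s : Diagram) :
    reduce (addCaret c (push a b s)) = reduce (addCaret c ((a, b) :: s)) := by
  fun_induction push a b s generalizing c with
  | case1 a b ih =>
    rw [ih]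
    rcases c with _ | c
    · simp [addCaret, reduce, push]
    · rw [addCaret, addCaret, Nat.add_succ, addCaret, reduce_cons, reduce_cons, reduce_cons,
        push_succ_succ_push]
  | case2 a b s ih =>
    rw [ih]
    rcases c with _ | c
    · simp [addCaret, reduce_cons, push_succ_succ_push]
    · rw [addCaret, addCaret, Nat.add_succ, addCaret, reduce_cons, reduce_cons, reduce_cons,
        push_succ_succ_push, add_zero]
  | case3 => cases c <;> simp [addCaret, reduce]
  | case4 => rfl

lemma reduce_removeCaret_push (c a b : ℕ) (s : Diagram) :
    reduce (removeCaret c (push a b s)) = reduce (removeCaret c ((a, b) :: s)) := by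
  fun_induction push a b s generalizing c with
  | case1 a b ih =>
    rw [ih]
    rcases c with _ | c
    · rcases b with _ | b <;> simp [removeCaret, reduce, push]
    · rw [removeCaret, removeCaret, Nat.add_succ, removeCaret, reduce_cons, reduce_cons,
        reduce_cons, push_succ_succ_push]
  | case2 a b s ih =>
    rw [ih]
    rcases c with _ | c
    · rcases b with _ | b <;> simp [removeCaret, reduce_cons, push_succ_succ_push]
    · rw [removeCaret, removeCaret, Nat.add_succ, removeCaret, reduce_cons, reduce_cons,
        reduce_cons, push_succ_succ_push, add_zero]
  | case3 => cases c <;> simp [removeCaret, reduce, push]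
  | case4 => rfl

lemma reduce_addCaret_reduce (c : ℕ) (t : Diagram) :
    reduce (addCaret c (reduce t)) = reduce (addCaret c t) := by
  induction t generalizing c with
  | nil => rfl
  | cons x t ih =>
    obtain ⟨a, b⟩ := x
    rw [reduce, reduce_addCaret_push]
    rcases c with _ | c
    · simp only [addCaret, reduce_cons, reduce_reduce]
    · simp only [addCaret, reduce_cons, ih]

lemma reduce_removeCaret_reduce (c : ℕ) (t : Diagram) :
    reduce (removeCaret c (reduce t)) = reduce (removeCaret c t) := by
  induction t generalizing c with
  | nil => rfl
  | cons x t ih =>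
    obtain ⟨a, b⟩ := x
    rw [reduce, reduce_removeCaret_push]
    rcases c with _ | c
    · rcases b with _ | b <;> simp only [removeCaret, reduce_cons, reduce_reduce]
    · simp only [removeCaret, reduce_cons, ih]

lemma reduce_removeCaret_addCaret (c : ℕ) (t : Diagram) :
    reduce (removeCaret c (addCaret c t)) = reduce t := by
  fun_induction addCaret c t with
  | case1 => rw [removeCaret]
  | case2 c a b t ih => rw [removeCaret, reduce_cons, ih, reduce_cons]
  | case3 => rw [removeCaret]; rfl
  | case4 c ih => rw [removeCaret, add_zero, reduce_cons, ih]; rfl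

lemma reduce_addCaret_removeCaret (c : ℕ) (t : Diagram) :
    reduce (addCaret c (removeCaret c t)) = reduce t := by
  fun_induction removeCaret c t with
  | case1 a t => rw [addCaret, reduce_cons, reduce_cons, push_succ_succ_push, reduce_cons]
  | case2 => rw [addCaret]
  | case3 c a b t ih => rw [addCaret, reduce_cons, ih, reduce_cons]
  | case4 => rw [addCaret]; rfl
  | case5 c ih => rw [addCaret, add_zero, reduce_cons, ih]; rfl

lemma addCaret_addCaret_of_lt {i j : ℕ} (h : i < j) (t : Diagram) :
    addCaret j (addCaret i t) = addCaret i (addCaret (j + 1) t) := by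
  fun_induction addCaret i t generalizing j with
  | case1 a b t =>
    obtain ⟨j, rfl⟩ := Nat.exists_eq_succ_of_ne_zero h.ne'
    simp only [addCaret, Nat.succ_eq_add_one]
    congr 2; omega
  | case2 c a b t ih =>
    obtain ⟨j, rfl⟩ := Nat.exists_eq_succ_of_ne_zero (Nat.ne_zero_of_lt h)
    simp only [addCaret, Nat.succ_eq_add_one]
    rw [ih (by omega)]
    congr 3; omega
  | case3 =>
    obtain ⟨j, rfl⟩ := Nat.exists_eq_succ_of_ne_zero h.ne'
    simp only [addCaret, Nat.succ_eq_add_one]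
  | case4 c ih =>
    obtain ⟨j, rfl⟩ := Nat.exists_eq_succ_of_ne_zero (Nat.ne_zero_of_lt h)
    simp only [addCaret, Nat.succ_eq_add_one, add_zero]
    rw [ih (by omega), addCaret]

/-! ### The action of Thompson's group on diagrams -/

/-- Two diagrams are equivalent if they have the same reduced form. -/
abbrev diagramSetoid : Setoid Diagram := Setoid.ker reduce

/-- Diagrams up to reduction. -/
abbrev ReducedDiagram : Type := Quotient diagramSetoid

/-- The permutation of the reduced diagrams that adds a caret at the root `c`. -/
def caretPerm (c : ℕ) : Equiv.Perm ReducedDiagram where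
  toFun := Quotient.map (addCaret c) fun s t h => by
    change reduce _ = reduce _
    rw [← reduce_addCaret_reduce, show reduce s = reduce t from h, reduce_addCaret_reduce]
  invFun := Quotient.map (removeCaret c) fun s t h => by
    change reduce _ = reduce _
    rw [← reduce_removeCaret_reduce, show reduce s = reduce t from h, reduce_removeCaret_reduce]
  left_inv := by
    rintro ⟨t⟩
    exact Quotient.sound (reduce_removeCaret_addCaret c t)
  right_inv := by
    rintro ⟨t⟩
    exact Quotient.sound (reduce_addCaret_removeCaret c t)

lemma caretPerm_mk (c : ℕ) (t : Diagram) :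
    caretPerm c (Quotient.mk diagramSetoid t) = Quotient.mk diagramSetoid (addCaret c t) := rfl

lemma caretPerm_inv_mk (c : ℕ) (t : Diagram) :
    (caretPerm c)⁻¹ (Quotient.mk diagramSetoid t) = Quotient.mk diagramSetoid (removeCaret c t) :=
  rfl

lemma caretPerm_mul_caretPerm {i j : ℕ} (h : i < j) :
    caretPerm j * caretPerm i = caretPerm i * caretPerm (j + 1) := by
  ext ⟨t⟩
  exact congrArg (Quotient.mk diagramSetoid) (addCaret_addCaret_of_lt h t)

/-- The action of Thompson's group on the reduced diagrams. -/
def caretHom : ThompsonF →* Equiv.Perm ReducedDiagram :=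
  PresentedGroup.toGroup (f := caretPerm) <| by
    rintro _ ⟨i, j, h, rfl⟩
    simp only [map_mul, map_inv, FreeGroup.lift_apply_of]
    rw [mul_inv_eq_one, mul_assoc, inv_mul_eq_iff_eq_mul, caretPerm_mul_caretPerm h]

lemma caretHom_x (n : ℕ) : caretHom (x n) = caretPerm n := PresentedGroup.toGroup.of _

/-- The reduced diagram of an element of Thompson's group. -/
def diagram (f : ThompsonF) : ReducedDiagram := caretHom f⁻¹ (Quotient.mk diagramSetoid [])

lemma diagram_one : diagram 1 = Quotient.mk diagramSetoid [] := by
  simp [diagram]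

lemma diagram_mul_x (f : ThompsonF) (n : ℕ) : diagram (f * x n) = (caretPerm n)⁻¹ (diagram f) := by
  simp [diagram, caretHom_x]

lemma diagram_mul_x_inv (f : ThompsonF) (n : ℕ) :
    diagram (f * (x n)⁻¹) = caretPerm n (diagram f) := by
  simp [diagram, caretHom_x]

lemma diagram_mul_x_of_eq {f : ThompsonF} {t : Diagram}
    (h : diagram f = Quotient.mk diagramSetoid t) (n : ℕ) :
    diagram (f * x n) = Quotient.mk diagramSetoid (removeCaret n t) := by
  rw [diagram_mul_x, h, caretPerm_inv_mk]

lemma diagram_mul_x_inv_of_eq {f : ThompsonF} {t : Diagram}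
    (h : diagram f = Quotient.mk diagramSetoid t) (n : ℕ) :
    diagram (f * (x n)⁻¹) = Quotient.mk diagramSetoid (addCaret n t) := by
  rw [diagram_mul_x_inv, h, caretPerm_mk]

/-! ### The length of a diagram

The spaces between consecutive leaves of a pointed forest are labelled; the length of a diagram is
the number of its carets plus the sum of a weight that depends on the two labels of each space
(Belk and Brown). -/

/-- The label of a space in a pointed forest. -/
inductive SpaceLabel : Type
  | left
  | next
  | right
  | inner

/-- The label of the space in front of a leaf with `a` carets, where `d` subtrees of the current
tree are still to be read and `p` trees, up to the one at the pointer, are still to begin. -/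
def spaceLabel (d p a : ℕ) : SpaceLabel :=
  if d = 0 ∧ p ≠ 0 then .left else if a ≠ 0 then .next else if d = 0 then .right else .inner

/-- The weight of a space; `s` tells whether there are carets to the right of it. -/
def weight (s : Bool) : SpaceLabel → SpaceLabel → ℕ
  | .left, .left => 2
  | .left, _ => 1
  | _, .left => 1
  | .next, _ => 2
  | _, .next => 2
  | .right, .right => if s then 2 else 0
  | _, _ => 0

/-- Whether a diagram has carets. -/
def hasCaret (t : Diagram) : Bool := t.any fun x => x ≠ (0, 0)

/-- The state of `spaceLabel` after a leaf at which a tree may begin. -/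
def nextPointer (d p : ℕ) : ℕ := if d = 0 then p - 1 else p

/-- The cost of the leaves without carets that follow the support of a diagram. -/
def tailCost (d p e q : ℕ) : ℕ :=
  if d = 0 ∧ p = 0 ∧ e = 0 ∧ q = 0 then 0
  else weight false (spaceLabel d p 0) (spaceLabel e q 0) +
    tailCost (d - 1) (nextPointer d p) (e - 1) (nextPointer e q)
termination_by d + p + e + q
decreasing_by
  simp only [nextPointer]
  split_ifs <;> omega

/-- The cost of the leaves of a diagram, read from a given state on. -/
def cost (d p e q : ℕ) : Diagram → ℕ
  | [] => tailCost d p e q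
  -- The leaf uses up one pending subtree and opens `a` new ones. At `d = 0` it begins a tree, and
  -- the truncated `d - 1` is rightly 0.
  | (a, b) :: t => weight (hasCaret t) (spaceLabel d p a) (spaceLabel e q b) + a + b +
      cost (d - 1 + a) (nextPointer d p) (e - 1 + b) (nextPointer e q) t

lemma cost_cons (d p e q a b : ℕ) (t : Diagram) :
    cost d p e q ((a, b) :: t) = weight (hasCaret t) (spaceLabel d p a) (spaceLabel e q b) + a + b +
      cost (d - 1 + a) (nextPointer d p) (e - 1 + b) (nextPointer e q) t := rfl

/-- This lets the inductions below read past the end of the list as if bare leaves followed. -/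
lemma cost_nil (d p e q : ℕ) : cost d p e q [] = cost d p e q [(0, 0)] := by
  rw [cost, cost, cost, tailCost]
  split_ifs with h
  · obtain ⟨rfl, rfl, rfl, rfl⟩ := h
    rw [tailCost]
    simp [weight, spaceLabel, nextPointer, hasCaret]
  · rfl

/-- The first entry of a diagram. -/
def head (t : Diagram) : ℕ × ℕ := t.headD (0, 0)

lemma cost_eq (d p e q : ℕ) (t : Diagram) :
    cost d p e q t = weight (hasCaret t.tail) (spaceLabel d p (head t).1)
      (spaceLabel e q (head t).2) + (head t).1 + (head t).2 +
      cost (d - 1 + (head t).1) (nextPointer d p) (e - 1 + (head t).2) (nextPointer e q) t.tail := by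
  rcases t with _ | ⟨⟨a, b⟩, t⟩
  · rw [cost_nil]; rfl
  · rfl

/-- The number of carets of the second forest. -/
def caretCount (t : Diagram) : ℕ := (t.map Prod.snd).sum

lemma caretCount_eq (t : Diagram) : caretCount t = (head t).2 + caretCount t.tail := by
  rcases t with _ | ⟨⟨a, b⟩, t⟩ <;> simp [caretCount, head]

/-! ### Change of the size under one generator -/

lemma spaceLabel_left (q b : ℕ) : spaceLabel 0 (q + 1) b = .left := by simp [spaceLabel]

lemma spaceLabel_succ (e q b : ℕ) : spaceLabel (e + 1) q b = if b = 0 then .inner else .next := by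
  rcases b with _ | b <;> simp [spaceLabel]

lemma spaceLabel_zero_zero (b : ℕ) : spaceLabel 0 0 b = if b = 0 then .right else .next := by
  rcases b with _ | b <;> simp [spaceLabel]

lemma nextPointer_zero (q : ℕ) : nextPointer 0 (q + 1) = q := rfl

lemma nextPointer_zero_zero : nextPointer 0 0 = 0 := rfl

lemma nextPointer_succ (e q : ℕ) : nextPointer (e + 1) q = q := rfl

/-- Moving the pointer changes the cost by at most one. -/
lemma cost_pointer (t : Diagram) (d p e q : ℕ) :
    cost d p e (q + 1) t ≤ cost d p e q t + 1 ∧ cost d p e q t ≤ cost d p e (q + 1) t + 1 := by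
  -- The measure drops at every leaf, even past the end of the list: the carets of the leaf move
  -- from `caretCount` to `e`, while one pending subtree or one tree before the pointer is used up.
  induction h : e + q + caretCount t using Nat.strong_induction_on generalizing t d p e q with
  | _ n ih =>
  rw [cost_eq d p e (q + 1), cost_eq d p e q]
  have hc := caretCount_eq t
  rcases e with _ | e
  · rcases q with _ | q
    · rw [nextPointer_zero, nextPointer_zero_zero, spaceLabel_left, spaceLabel_zero_zero]
      split_ifs <;> rcases spaceLabel d p (head t).1 <;> rcases hasCaret t.tail <;>
        simp only [weight] <;> simp <;> omega
    · rw [nextPointer_zero, nextPointer_zero, spaceLabel_left, spaceLabel_left]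
      have := ih (0 - 1 + (head t).2 + q + caretCount t.tail) (by omega) t.tail
        (d - 1 + (head t).1) (nextPointer d p) _ _ rfl
      omega
  · rw [nextPointer_succ, nextPointer_succ, spaceLabel_succ, spaceLabel_succ]
    have := ih (e + 1 - 1 + (head t).2 + q + caretCount t.tail) (by omega) t.tail
      (d - 1 + (head t).1) (nextPointer d p) _ _ rfl
    omega

/-- The effect on the later leaves of joining the tree at the pointer to the next one. -/
lemma cost_join (t : Diagram) (d p e : ℕ) :
    cost d p (e + 1) 0 t ≤ cost d p e 0 t ∧ cost d p e 0 t ≤ cost d p (e + 1) 0 t + 2 := by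
  induction h : e + caretCount t using Nat.strong_induction_on generalizing t d p e with
  | _ n ih =>
  rw [cost_eq d p (e + 1), cost_eq d p e]
  have hc := caretCount_eq t
  rcases e with _ | e
  · rw [nextPointer_succ, nextPointer_zero_zero, spaceLabel_succ, spaceLabel_zero_zero]
    split_ifs <;> rcases spaceLabel d p (head t).1 <;> rcases hasCaret t.tail <;>
      (simp [weight]; try omega)
  · rw [nextPointer_succ, nextPointer_succ, spaceLabel_succ, spaceLabel_succ]
    have := ih (e + (head t).2 + caretCount t.tail) (by omega) t.tail
      (d - 1 + (head t).1) (nextPointer d p) (e + (head t).2) rfl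
    rw [show e + 1 + 1 - 1 + (head t).2 = e + (head t).2 + 1 by omega,
      show e + 1 - 1 + (head t).2 = e + (head t).2 by omega]
    omega

lemma weight_left_right (s s' : Bool) (X : SpaceLabel) :
    weight s X .left = weight s' X .left := by
  rcases X <;> rfl

lemma weight_congr (s s' : Bool) (X : SpaceLabel) {e q b : ℕ} (h : e ≠ 0 ∨ q ≠ 0) :
    weight s X (spaceLabel e q b) = weight s' X (spaceLabel e q b) := by
  simp only [spaceLabel]
  split_ifs <;> rcases X <;> first | rfl | omega

/-- The length of a diagram, increased by two. -/
def size (t : Diagram) : ℕ := cost 0 ((head t).1 + 1) 0 ((head t).2 + 1) t.tail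

lemma size_eq (t : Diagram) :
    size t = 2 + (head t.tail).1 + (head t.tail).2 +
      cost (head t.tail).1 (head t).1 (head t.tail).2 (head t).2 t.tail.tail := by
  rw [size, cost_eq, spaceLabel_left, spaceLabel_left, nextPointer_zero, nextPointer_zero]
  simp [weight]

lemma addCaret_zero (t : Diagram) :
    addCaret 0 t = ((head t).1, (head t).2 + 1) :: t.tail := by
  rcases t with _ | ⟨⟨a, b⟩, t⟩ <;> simp [addCaret, head]

lemma addCaret_succ (c : ℕ) (t : Diagram) :
    addCaret (c + 1) t = ((head t).1, (head t).2) :: addCaret (c + (head t).2) t.tail := by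
  rcases t with _ | ⟨⟨a, b⟩, t⟩ <;> simp [addCaret, head]

lemma removeCaret_succ (c : ℕ) (t : Diagram) :
    removeCaret (c + 1) t = ((head t).1, (head t).2) :: removeCaret (c + (head t).2) t.tail := by
  rcases t with _ | ⟨⟨a, b⟩, t⟩ <;> simp [removeCaret, head]

/-- Root `q + e` is the pointed tree. The caret costs 1, and by `cost_join` the tree swallowed on
its right does not become more expensive. -/
lemma cost_addCaret_le (t : Diagram) (d p e q : ℕ) :
    cost d p e (q + 1) (addCaret (q + e) t) ≤ cost d p e (q + 1) t + 1 := by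
  induction h : e + q + caretCount t using Nat.strong_induction_on generalizing t d p e q with
  | _ n ih =>
  have hc := caretCount_eq t
  rw [cost_eq d p e (q + 1) t]
  rcases e with _ | e
  · rcases q with _ | q
    · rw [addCaret_zero, cost_cons]
      simp only [spaceLabel_left, nextPointer_zero]
      have := cost_join t.tail (d - 1 + (head t).1) (nextPointer d p) (0 - 1 + (head t).2)
      rw [← add_assoc (0 - 1)]
      omega
    · rw [add_zero, addCaret_succ, cost_cons, weight_congr _ (hasCaret t.tail) _ (by simp)]
      have := ih (0 - 1 + (head t).2 + q + caretCount t.tail) (by omega) t.tail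
        (d - 1 + (head t).1) (nextPointer d p) _ _ rfl
      rw [nextPointer_zero, show q + (head t).2 = q + (0 - 1 + (head t).2) by omega]
      omega
  · rw [← add_assoc, addCaret_succ, cost_cons, weight_congr _ (hasCaret t.tail) _ (by simp)]
    have := ih (e + 1 - 1 + (head t).2 + q + caretCount t.tail) (by omega) t.tail
      (d - 1 + (head t).1) (nextPointer d p) _ _ rfl
    rw [nextPointer_succ, show q + e + (head t).2 = q + (e + 1 - 1 + (head t).2) by omega]
    omega

/-- The new space is `inner` opposite `right` and weighs nothing, so only the new caret counts. -/
lemma cost_split (t : Diagram) (d p a : ℕ) :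
    cost d p 0 1 ((a + 1, 0) :: (0, 0) :: t) = cost d p 0 1 ((a, 0) :: t) + 1 := by
  simp only [cost_cons, spaceLabel_left, nextPointer_zero, add_zero, Nat.zero_sub]
  rw [← add_assoc (d - 1), spaceLabel_succ, spaceLabel_zero_zero, nextPointer_succ,
    nextPointer_zero_zero]
  simp only [if_true, Nat.add_sub_cancel]
  have : weight (hasCaret ((0, 0) :: t)) (spaceLabel d p (a + 1)) .left =
      weight (hasCaret t) (spaceLabel d p a) .left := by
    simp only [spaceLabel]
    split_ifs <;> rfl
  rw [this]
  simp only [weight]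
  ring

/-- Either a caret disappears, and the freed subtree costs at most 2 more, or a bare leaf is split.
-/
lemma cost_removeCaret_le (t : Diagram) (d p e q : ℕ) :
    cost d p e (q + 1) (removeCaret (q + e) t) ≤ cost d p e (q + 1) t + 1 := by
  induction h : e + q + caretCount t using Nat.strong_induction_on generalizing t d p e q with
  | _ n ih =>
  have hc := caretCount_eq t
  rcases e with _ | e
  · rcases q with _ | q
    · rcases t with _ | ⟨⟨a, _ | b⟩, t⟩
      · rw [removeCaret, cost_nil d p 0 (0 + 1), ← cost_split, cost_cons _ _ _ _ _ _ [],
          cost_cons _ _ _ _ _ _ [(0, 0)], cost_nil _ _ (0 - 1 + 0)]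
        rfl
      · rw [removeCaret, cost_split]
      · rw [removeCaret, cost_cons, cost_cons]
        simp only [spaceLabel_left, nextPointer_zero]
        have := cost_join t (d - 1 + a) (nextPointer d p) (0 - 1 + b)
        rw [← add_assoc (0 - 1)]
        omega
    · rw [cost_eq d p 0 (q + 1 + 1) t]
      rw [add_zero, removeCaret_succ, cost_cons, weight_congr _ (hasCaret t.tail) _ (by simp)]
      have := ih (0 - 1 + (head t).2 + q + caretCount t.tail) (by omega) t.tail
        (d - 1 + (head t).1) (nextPointer d p) _ _ rfl
      rw [nextPointer_zero, show q + (head t).2 = q + (0 - 1 + (head t).2) by omega]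
      omega
  · rw [cost_eq d p (e + 1) (q + 1) t]
    rw [← add_assoc, removeCaret_succ, cost_cons, weight_congr _ (hasCaret t.tail) _ (by simp)]
    have := ih (e + 1 - 1 + (head t).2 + q + caretCount t.tail) (by omega) t.tail
      (d - 1 + (head t).1) (nextPointer d p) _ _ rfl
    rw [nextPointer_succ, show q + e + (head t).2 = q + (e + 1 - 1 + (head t).2) by omega]
    omega

lemma size_addCaret_zero_le (t : Diagram) : size (addCaret 0 t) ≤ size t + 1 := by
  rw [addCaret_zero]
  exact (cost_pointer t.tail 0 ((head t).1 + 1) 0 ((head t).2 + 1)).1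

/-- When the pointer is already leftmost, the split at leaf 0 creates a space of weight 2, but the
space in front of the formerly pointed tree drops from weight 2 to 1. -/
lemma size_removeCaret_zero_le (t : Diagram) : size (removeCaret 0 t) ≤ size t + 1 := by
  have key (a : ℕ) (t : Diagram) : size ((a + 1, 0) :: (0, 0) :: t) ≤ size ((a, 0) :: t) + 1 := by
    rw [size_eq]
    simp only [size, head, List.headD_cons, List.tail_cons]
    rw [cost_eq 0 (a + 1) 0 0, cost_eq 0 (a + 1) 0 (0 + 1)]
    simp only [spaceLabel_left, spaceLabel_zero_zero, nextPointer_zero, nextPointer_zero_zero]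
    split_ifs <;> simp only [weight] <;> omega
  rcases t with _ | ⟨⟨a, _ | b⟩, t⟩
  · rw [removeCaret]
    refine le_trans (le_of_eq ?_) ((key 0 []).trans (le_of_eq ?_))
    · exact cost_nil _ _ _ _
    · rfl
  · rw [removeCaret]
    exact key a t
  · rw [removeCaret]
    exact (cost_pointer t 0 (a + 1) 0 (b + 1)).2

lemma size_addCaret_one_le (t : Diagram) : size (addCaret 1 t) ≤ size t + 1 := by
  rw [addCaret_succ, zero_add]
  exact cost_addCaret_le t.tail 0 ((head t).1 + 1) 0 (head t).2

lemma size_removeCaret_one_le (t : Diagram) : size (removeCaret 1 t) ≤ size t + 1 := by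
  rw [removeCaret_succ, zero_add]
  exact cost_removeCaret_le t.tail 0 ((head t).1 + 1) 0 (head t).2

/-! ### Reduction does not increase the length -/

lemma weight_mono {s s' : Bool} (h : s = true → s' = true) (X Y : SpaceLabel) :
    weight s X Y ≤ weight s' X Y := by
  rcases X <;> rcases Y <;> simp only [weight, le_refl]
  split_ifs <;> simp_all

lemma hasCaret_cons (x : ℕ × ℕ) (t : Diagram) :
    hasCaret (x :: t) = (decide (x ≠ (0, 0)) || hasCaret t) := by
  simp [hasCaret]

/-- Cancelling can only change a label `next` in front of the caret, and `next` opposite `next` is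
the heaviest combination without `left`. -/
lemma cost_cancel_le (d p e q a b : ℕ) (s : Diagram) :
    cost d p e q ((a, b) :: s) ≤ cost d p e q ((a + 1, b + 1) :: (0, 0) :: s) := by
  simp only [cost_cons, ← add_assoc, Nat.add_sub_cancel, nextPointer_succ, add_zero]
  have : weight (hasCaret s) (spaceLabel d p a) (spaceLabel e q b) ≤
      weight (hasCaret ((0, 0) :: s)) (spaceLabel d p (a + 1)) (spaceLabel e q (b + 1)) := by
    simp only [spaceLabel]
    split_ifs <;> rcases hasCaret s <;> simp_all [weight]
  omega

lemma cost_push_le (a b : ℕ) (s : Diagram) (d p e q : ℕ) :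
    cost d p e q (push a b s) ≤ cost d p e q ((a, b) :: s) := by
  fun_induction push a b s generalizing d p e q with
  | case1 a b ih =>
    refine (ih d p e q).trans ((cost_cancel_le d p e q a b []).trans (le_of_eq ?_))
    rw [cost_cons d p e q (a + 1) (b + 1) [(0, 0)], ← cost_nil]
    rfl
  | case2 a b s ih => exact (ih d p e q).trans (cost_cancel_le d p e q a b s)
  | case3 => exact (cost_nil _ _ _ _).le
  | case4 => exact le_rfl

lemma hasCaret_push (a b : ℕ) (s : Diagram) :
    hasCaret (push a b s) = true → hasCaret ((a, b) :: s) = true := by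
  fun_induction push a b s with
  | case1 => simp [hasCaret_cons]
  | case2 => simp [hasCaret_cons]
  | case3 => simp [hasCaret]
  | case4 => exact id

lemma hasCaret_reduce (t : Diagram) : hasCaret (reduce t) = true → hasCaret t = true := by
  induction t with
  | nil => exact id
  | cons x t ih =>
    intro h
    have := hasCaret_push _ _ _ h
    rw [hasCaret_cons, Bool.or_eq_true] at this ⊢
    exact this.imp id ih

lemma cost_reduce_le (t : Diagram) (d p e q : ℕ) : cost d p e q (reduce t) ≤ cost d p e q t := by
  induction t generalizing d p e q with
  | nil => exact le_rfl
  | cons x t ih =>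
    refine (cost_push_le _ _ _ _ _ _ _).trans ?_
    rw [cost_cons, cost_cons]
    exact add_le_add (Nat.add_le_add_right (Nat.add_le_add_right
      (weight_mono (hasCaret_reduce t) _ _) _) _) (ih _ _ _ _)

lemma size_cancel (a b : ℕ) (s : Diagram) :
    size ((a + 1, b + 1) :: (0, 0) :: s) = size ((a, b) :: s) + 2 := by
  rw [size_eq, add_comm]
  rfl

lemma size_push_le (a b : ℕ) (s : Diagram) : size (push a b s) ≤ size ((a, b) :: s) := by
  fun_induction push a b s with
  | case1 a b ih =>
    refine ih.trans ((Nat.le_add_right _ 2).trans (le_of_eq ?_))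
    rw [← size_cancel]
    exact (cost_nil _ _ _ _).symm
  | case2 a b s ih => exact ih.trans (by rw [size_cancel]; exact Nat.le_add_right _ 2)
  | case3 => exact le_rfl
  | case4 => exact le_rfl

lemma size_reduce_le (t : Diagram) : size (reduce t) ≤ size t := by
  rcases t with _ | ⟨x, t⟩
  · exact le_rfl
  · exact (size_push_le _ _ _).trans (cost_reduce_le t _ _ _ _)

/-! ### The lower bound for the word length -/

/-- The length of a reduced diagram, increased by two. -/
def reducedSize : ReducedDiagram → ℕ :=
  Quotient.lift (fun t => size (reduce t)) fun _ _ h => congrArg size h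

lemma reducedSize_mk (t : Diagram) :
    reducedSize (Quotient.mk diagramSetoid t) = size (reduce t) := rfl

lemma reducedSize_caretPerm_le {c : ℕ} (hc : c ≤ 1) (D : ReducedDiagram) :
    reducedSize (caretPerm c D) ≤ reducedSize D + 1 := by
  obtain ⟨t⟩ := D
  change size (reduce (addCaret c t)) ≤ size (reduce t) + 1
  rw [← reduce_addCaret_reduce]
  refine (size_reduce_le _).trans ?_
  interval_cases c
  exacts [size_addCaret_zero_le _, size_addCaret_one_le _]

lemma reducedSize_caretPerm_inv_le {c : ℕ} (hc : c ≤ 1) (D : ReducedDiagram) :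
    reducedSize ((caretPerm c)⁻¹ D) ≤ reducedSize D + 1 := by
  obtain ⟨t⟩ := D
  change size (reduce (removeCaret c t)) ≤ size (reduce t) + 1
  rw [← reduce_removeCaret_reduce]
  refine (size_reduce_le _).trans ?_
  interval_cases c
  exacts [size_removeCaret_zero_le _, size_removeCaret_one_le _]

lemma reducedSize_diagram_mul_le (f : ThompsonF) {s : ThompsonF}
    (hs : s ∈ stdGens ∨ s⁻¹ ∈ stdGens) :
    reducedSize (diagram (f * s)) ≤ reducedSize (diagram f) + 1 := by
  have key (s : ThompsonF) (hs : s ∈ stdGens) : ∃ c ≤ 1, s = x c := by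
    rcases hs with rfl | rfl
    exacts [⟨0, by simp, rfl⟩, ⟨1, le_rfl, rfl⟩]
  rcases hs with hs | hs
  · obtain ⟨c, hc, rfl⟩ := key s hs
    rw [diagram_mul_x]
    exact reducedSize_caretPerm_inv_le hc _
  · obtain ⟨c, hc, h⟩ := key _ hs
    obtain rfl := inv_eq_iff_eq_inv.1 h
    rw [diagram_mul_x_inv]
    exact reducedSize_caretPerm_le hc _

lemma reducedSize_diagram_prod_le (L : List ThompsonF) (hL : ∀ s ∈ L, s ∈ stdGens ∨ s⁻¹ ∈ stdGens)
    (f : ThompsonF) : reducedSize (diagram (f * L.prod)) ≤ reducedSize (diagram f) + L.length := by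
  induction L generalizing f with
  | nil => simp
  | cons s L ih =>
    rw [List.prod_cons, ← mul_assoc, List.length_cons]
    have h₁ := ih (fun a ha => hL a (List.mem_cons_of_mem _ ha)) (f * s)
    have h₂ := reducedSize_diagram_mul_le f (hL s List.mem_cons_self)
    omega

end ThompsonF

/-! ### Word length -/

section WordLength

variable {G : Type*} [Group G] {X : Set G}

lemma wordLength_le {w : G} (L : List G) (hL : ∀ a ∈ L, a ∈ X ∨ a⁻¹ ∈ X) (h : L.prod = w) :
    wordLength X w ≤ L.length := Nat.sInf_le ⟨L, hL, h, rfl⟩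

lemma exists_word (hX : Subgroup.closure X = ⊤) (w : G) :
    ∃ L : List G, (∀ a ∈ L, a ∈ X ∨ a⁻¹ ∈ X) ∧ L.prod = w ∧ L.length = wordLength X w := by
  have hw : w ∈ (Subgroup.closure X).toSubmonoid := by simp [hX]
  rw [Subgroup.closure_toSubmonoid] at hw
  obtain ⟨L, hL, h⟩ := Submonoid.exists_list_of_mem_closure hw
  exact Nat.sInf_mem (s := {n : ℕ | ∃ L : List G, (∀ a ∈ L, a ∈ X ∨ a⁻¹ ∈ X) ∧
    L.prod = w ∧ L.length = n}) ⟨_, L, hL, h, rfl⟩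

lemma wordLength_mul_le (hX : Subgroup.closure X = ⊤) (v w : G) :
    wordLength X (v * w) ≤ wordLength X v + wordLength X w := by
  obtain ⟨L, hL, rfl, h⟩ := exists_word hX v
  obtain ⟨M, hM, rfl, h'⟩ := exists_word hX w
  rw [← h, ← h', ← List.length_append]
  exact wordLength_le _ (fun a ha => (List.mem_append.1 ha).elim (hL a) (hM a)) List.prod_append

lemma wordLength_le_one {g : G} (hg : g ∈ X ∨ g⁻¹ ∈ X) : wordLength X g ≤ 1 :=
  wordLength_le [g] (by simpa using hg) List.prod_singleton

lemma wordLength_pow_le (hX : Subgroup.closure X = ⊤) (g : G) (n : ℕ) :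
    wordLength X (g ^ n) ≤ n * wordLength X g := by
  induction n with
  | zero =>
    rw [pow_zero, zero_mul]
    exact wordLength_le [] (by simp) rfl
  | succ n ih =>
    rw [pow_succ, Nat.succ_mul]
    exact (wordLength_mul_le hX _ _).trans (Nat.add_le_add_right ih _)

lemma wordLength_generator_pow_le (hX : Subgroup.closure X = ⊤) {g : G} (hg : g ∈ X ∨ g⁻¹ ∈ X)
    (n : ℕ) : wordLength X (g ^ n) ≤ n :=
  (wordLength_pow_le hX g n).trans
    ((Nat.mul_le_mul_left n (wordLength_le_one hg)).trans (mul_one n).le)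

/-- If `w * g ^ n` is shorter than `w` by `n`, then the lengths of the elements `w * g ^ i` decrease
by one in each step. -/
lemma wordLength_mul_pow (hX : Subgroup.closure X = ⊤) {g w : G} (hg : g ∈ X ∨ g⁻¹ ∈ X) {n i : ℕ}
    (h : wordLength X (w * g ^ n) + n ≤ wordLength X w) (hi : i ≤ n) :
    wordLength X (w * g ^ i) + i = wordLength X w := by
  -- Returning from `w * g ^ i` to `w` gives the lower bound, returning from `w * g ^ n` to `w * g ^
  -- i` the upper one.
  have h₁ := wordLength_mul_le hX (w * g ^ i) (g⁻¹ ^ i)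
  have h₂ := wordLength_mul_le hX (w * g ^ n) (g⁻¹ ^ (n - i))
  have hg' : g⁻¹ ∈ X ∨ g⁻¹⁻¹ ∈ X := by simpa using hg.symm
  have h₃ := wordLength_generator_pow_le hX hg' i
  have h₄ := wordLength_generator_pow_le hX hg' (n - i)
  rw [inv_pow, mul_inv_cancel_right] at h₁
  rw [inv_pow, mul_assoc, ← zpow_natCast, ← zpow_natCast, ← zpow_neg, ← zpow_add,
    show (n : ℤ) + -((n - i : ℕ) : ℤ) = i by omega, zpow_natCast] at h₂
  rw [inv_pow] at h₃ h₄
  simp only [zpow_neg, zpow_natCast] at h₂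
  omega

end WordLength

namespace ThompsonF

/-! ### Generation by two elements and the lower bound -/

lemma x_zero_mem : x 0 ∈ stdGens := Or.inl rfl

lemma x_one_mem : x 1 ∈ stdGens := Or.inr rfl

lemma x_mul_x {i j : ℕ} (h : i < j) : x j * x i = x i * x (j + 1) := by
  have : (x i)⁻¹ * x j * x i * (x (j + 1))⁻¹ = 1 :=
    PresentedGroup.one_of_mem (rels := thompsonRels) ⟨i, j, h, rfl⟩
  rw [mul_inv_eq_one, mul_assoc, inv_mul_eq_iff_eq_mul] at this
  exact this

lemma closure_stdGens : Subgroup.closure stdGens = ⊤ := by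
  have h (n : ℕ) : x (n + 1) ∈ Subgroup.closure stdGens := by
    induction n with
    | zero => exact Subgroup.subset_closure x_one_mem
    | succ n ih =>
      have h₀ : x 0 ∈ Subgroup.closure stdGens := Subgroup.subset_closure x_zero_mem
      rw [← inv_mul_eq_iff_eq_mul.2 (x_mul_x n.succ_pos)]
      exact mul_mem (inv_mem h₀) (mul_mem ih h₀)
  rw [eq_top_iff, ← PresentedGroup.closure_range_of, Subgroup.closure_le]
  rintro _ ⟨n, rfl⟩
  rcases n with _ | n
  exacts [Subgroup.subset_closure x_zero_mem, h n]

/-- The length of the reduced diagram of an element is a lower bound for its word length. -/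
lemma reducedSize_diagram_le (f : ThompsonF) :
    reducedSize (diagram f) ≤ wordLength stdGens f + 2 := by
  obtain ⟨L, hL, rfl, h⟩ := exists_word closure_stdGens f
  rw [← h, ← one_mul L.prod]
  refine (reducedSize_diagram_prod_le L hL 1).trans (le_of_eq ?_)
  rw [diagram_one, add_comm]
  congr 1
  rw [reducedSize_mk, reduce, size_eq]
  simp [head, cost, tailCost]

/-! ### The diagrams of the seesaw words -/

/-- A nonempty diagram that is reduced. -/
def IsReduced (t : Diagram) : Prop := t ≠ [] ∧ reduce t = t

lemma IsReduced.cons {a b : ℕ} {t : Diagram} (ht : IsReduced t) (h : a = 0 ∨ b = 0) :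
    IsReduced ((a, b) :: t) := by
  obtain ⟨ht, ht'⟩ := ht
  obtain ⟨x, s, rfl⟩ := List.exists_cons_of_ne_nil ht
  exact ⟨by simp, by rw [reduce, ht', push_cons_of_eq_zero h]⟩

/-- The diagram that starts with `l + 1` carets of the second forest, next to each other, followed
by a caret of the first forest that overlaps the last one of these. -/
def caretRow : ℕ → Diagram
  | 0 => [(0, 1), (1, 0)]
  | l + 1 => (0, 1) :: (0, 0) :: caretRow l

lemma isReduced_caretRow (l : ℕ) : IsReduced (caretRow l) := by
  induction l with
  | zero => exact IsReduced.cons ⟨by simp, rfl⟩ (Or.inl rfl)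
  | succ l ih => exact (ih.cons (Or.inl rfl)).cons (Or.inl rfl)

lemma exists_caretRow_eq_cons (l : ℕ) : ∃ t, caretRow l = (0, 1) :: t := by
  cases l <;> exact ⟨_, rfl⟩

lemma hasCaret_caretRow (l : ℕ) : hasCaret (caretRow l) = true := by
  obtain ⟨t, ht⟩ := exists_caretRow_eq_cons l
  simp [ht, hasCaret_cons]

/-- `n` leaves without carets in front of a diagram. -/
def zeros : ℕ → Diagram → Diagram
  | 0, t => t
  | n + 1, t => (0, 0) :: zeros n t

lemma zeros_add (m n : ℕ) (t : Diagram) : zeros (m + n) t = zeros m (zeros n t) := by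
  induction m with
  | zero => rw [zero_add]; rfl
  | succ m ih => rw [Nat.succ_add, zeros, ih]; rfl

lemma IsReduced.zeros {t : Diagram} (ht : IsReduced t) (n : ℕ) :
    IsReduced (ThompsonF.zeros n t) := by
  induction n with
  | zero => exact ht
  | succ n ih => exact ih.cons (Or.inl rfl)

lemma addCaret_zeros (n c : ℕ) (t : Diagram) :
    addCaret (n + c) (zeros n t) = zeros n (addCaret c t) := by
  induction n with
  | zero => rw [zero_add]; rfl
  | succ n ih => rw [Nat.succ_add, zeros, addCaret, add_zero, ih]; rfl

lemma removeCaret_nil (c : ℕ) : removeCaret c [] = zeros c [(1, 0)] := by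
  induction c with
  | zero => rw [removeCaret]; rfl
  | succ n ih => rw [removeCaret, ih]; rfl

/-! ### Carets at the pointer of a seesaw diagram -/

lemma weight_inner (s s' : Bool) (X : SpaceLabel) : weight s X .inner = weight s' X .inner := by
  rcases X <;> rfl

/-- Opposite `left`, the labels `right` and `inner` have the same weight. -/
lemma cost_join_of_left (p : ℕ) (t : Diagram) : cost 0 (p + 1) 1 0 t = cost 0 (p + 1) 0 0 t := by
  rw [cost_eq, cost_eq 0 _ 0]
  simp only [spaceLabel_left, spaceLabel_succ 0, spaceLabel_zero_zero]
  split_ifs <;> rfl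

/-- The row begins with a caret of the second forest, so joining it to the tree before it can only
leave its label `next`. -/
lemma cost_join_caretRow (d p l : ℕ) : cost d p 1 0 (caretRow l) = cost d p 0 0 (caretRow l) := by
  obtain ⟨t, ht⟩ := exists_caretRow_eq_cons l
  rw [ht]
  rfl

lemma cost_addCaret_caretRow {i l : ℕ} (h : i < l) (p : ℕ) :
    cost 0 p 0 (i + 1) (addCaret i (caretRow l)) = cost 0 p 0 (i + 1) (caretRow l) + 1 ∧
      IsReduced (addCaret i (caretRow l)) := by
  induction i generalizing l p with
  | zero =>
    obtain ⟨l, rfl⟩ := Nat.exists_eq_succ_of_ne_zero h.ne'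
    rw [caretRow, addCaret]
    refine ⟨?_, ((isReduced_caretRow l).cons (Or.inl rfl)).cons (Or.inl rfl)⟩
    have := cost_join_caretRow 0 (nextPointer 0 (nextPointer 0 p)) l
    simp only [cost_cons, nextPointer_zero, nextPointer_succ, spaceLabel_succ, spaceLabel_left,
      Nat.zero_sub, zero_add, add_zero, Nat.add_sub_cancel, Nat.sub_self] at this ⊢
    simp only [Nat.reduceAdd, spaceLabel, nextPointer] at this ⊢
    simp at this ⊢
    omega
  | succ i ih =>
    obtain ⟨l, rfl⟩ := Nat.exists_eq_succ_of_ne_zero (Nat.ne_zero_of_lt h)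
    obtain ⟨h₁, h₂⟩ := ih (Nat.lt_of_succ_lt_succ h) (nextPointer 0 (nextPointer 0 p))
    rw [caretRow, addCaret, addCaret, add_zero]
    refine ⟨?_, (h₂.cons (Or.inl rfl)).cons (Or.inl rfl)⟩
    simp only [cost_cons, spaceLabel_left, spaceLabel_succ, if_true]
    rw [weight_left_right _ (hasCaret ((0, 0) :: caretRow l)),
      weight_inner _ (hasCaret (caretRow l))]
    simp only [nextPointer_zero, nextPointer_succ, add_zero, Nat.zero_sub, zero_add, Nat.sub_self]
      at h₁ ⊢
    omega

/-- The space under the removed caret turns from `right`–`inner`, of weight 0, into `right`–`right`,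
of weight 2 because `i < l` leaves carets further right. The bound on `p` keeps this space right of
the first pointer. -/
lemma cost_removeCaret_caretRow {i l : ℕ} (h : i < l) {p : ℕ} (hp : p ≤ 1) :
    cost 0 p 0 (i + 1) (removeCaret i (caretRow l)) = cost 0 p 0 (i + 1) (caretRow l) + 1 ∧
      IsReduced (removeCaret i (caretRow l)) := by
  have hp' : nextPointer 0 p = 0 := by simp only [nextPointer, if_true]; omega
  induction i generalizing l p with
  | zero =>
    obtain ⟨l, rfl⟩ := Nat.exists_eq_succ_of_ne_zero h.ne'
    rw [caretRow, removeCaret]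
    refine ⟨?_, ((isReduced_caretRow l).cons (Or.inl rfl)).cons (Or.inl rfl)⟩
    simp only [cost_cons, hp', spaceLabel_left, hasCaret_caretRow]
    rw [weight_left_right _ (hasCaret ((0, 0) :: caretRow l))]
    simp [spaceLabel, nextPointer, weight]
    omega
  | succ i ih =>
    obtain ⟨l, rfl⟩ := Nat.exists_eq_succ_of_ne_zero (Nat.ne_zero_of_lt h)
    obtain ⟨h₁, h₂⟩ := ih (Nat.lt_of_succ_lt_succ h) zero_le_one rfl
    rw [caretRow, removeCaret, removeCaret, add_zero]
    refine ⟨?_, (h₂.cons (Or.inl rfl)).cons (Or.inl rfl)⟩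
    simp only [cost_cons, spaceLabel_left, spaceLabel_succ, if_true, hp']
    rw [weight_left_right _ (hasCaret ((0, 0) :: caretRow l)),
      weight_inner _ (hasCaret (caretRow l))]
    simp only [nextPointer_zero, nextPointer_zero_zero, nextPointer_succ, add_zero, Nat.zero_sub,
      zero_add, Nat.sub_self] at h₁ ⊢
    omega

/-- If adding a caret behind a leaf without carets raises the cost by one, then this also holds in
front of the leaf. -/
lemma cost_zero_cons_add_one {d p c : ℕ} {s t : Diagram}
    (h : cost (d - 1) (nextPointer d p) 0 (c + 1) s =
      cost (d - 1) (nextPointer d p) 0 (c + 1) t + 1) :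
    cost d p 0 (c + 2) ((0, 0) :: s) = cost d p 0 (c + 2) ((0, 0) :: t) + 1 := by
  simp only [cost_cons, spaceLabel_left]
  rw [weight_left_right _ (hasCaret t)]
  simp only [nextPointer_zero, add_zero, Nat.zero_sub] at h ⊢
  omega

lemma cost_addCaret_zero_cons {d p p' : ℕ} (hd : d ≤ 1) (hp : nextPointer d p = p' + 1)
    (t : Diagram) :
    cost d p 0 1 (addCaret 0 ((0, 0) :: t)) = cost d p 0 1 ((0, 0) :: t) + 1 := by
  have := cost_join_of_left p' t
  rw [addCaret]
  simp only [cost_cons, spaceLabel_left, nextPointer_zero, hp, add_zero, Nat.zero_sub, zero_add,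
    Nat.sub_eq_zero_of_le hd, this]
  ring

lemma cost_addCaret_zeros {c n l : ℕ} (h : c < n + l) :
    cost 0 (n + 1) 0 (c + 1) (addCaret c (zeros n (caretRow l))) =
        cost 0 (n + 1) 0 (c + 1) (zeros n (caretRow l)) + 1 ∧
      IsReduced (addCaret c (zeros n (caretRow l))) := by
  induction n generalizing c with
  | zero => exact cost_addCaret_caretRow (by omega) 1
  | succ n ih =>
    rcases c with _ | c
    · exact ⟨cost_addCaret_zero_cons zero_le_one rfl _,
        by rw [zeros, addCaret]; exact ((isReduced_caretRow l).zeros n).cons (Or.inl rfl)⟩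
    · obtain ⟨h₁, h₂⟩ := ih (c := c) (by omega)
      rw [zeros, addCaret]
      exact ⟨cost_zero_cons_add_one h₁, h₂.cons (Or.inl rfl)⟩

lemma cost_removeCaret_zeros {c n l : ℕ} (h : c < n + l) :
    cost 0 (n + 1) 0 (c + 1) (removeCaret c (zeros n (caretRow l))) =
        cost 0 (n + 1) 0 (c + 1) (zeros n (caretRow l)) + 1 ∧
      IsReduced (removeCaret c (zeros n (caretRow l))) := by
  induction n generalizing c with
  | zero => exact cost_removeCaret_caretRow (by omega) le_rfl
  | succ n ih =>
    rcases c with _ | c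
    · rw [zeros, removeCaret]
      exact ⟨cost_split _ _ _ _,
        (((isReduced_caretRow l).zeros n).cons (Or.inl rfl)).cons (Or.inr rfl)⟩
    · obtain ⟨h₁, h₂⟩ := ih (c := c) (by omega)
      rw [zeros, removeCaret]
      exact ⟨cost_zero_cons_add_one h₁, h₂.cons (Or.inl rfl)⟩

/-- Each further caret costs 1, the space `right`–`next` in front of it 2, and the space under it
nothing. -/
lemma cost_caretRow (l : ℕ) : cost 0 0 0 0 (caretRow l) = 3 * l + 6 := by
  induction l with
  | zero => simp [caretRow, cost, spaceLabel, nextPointer, weight, tailCost]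
  | succ l ih =>
    simp [caretRow, cost_cons, spaceLabel, nextPointer, weight, ih]
    ring

lemma cost_zeros_caretRow (n : ℕ) {l : ℕ} (hl : 1 ≤ l) :
    cost 0 (n + 1) 0 (n + 1) (zeros n (caretRow l)) = 2 * n + 3 * l + 6 := by
  induction n with
  | zero =>
    obtain ⟨l, rfl⟩ := Nat.exists_eq_succ_of_ne_zero (Nat.ne_zero_of_lt hl)
    have := cost_caretRow l
    simp [zeros, caretRow, cost_cons, spaceLabel, nextPointer, weight, this]
    ring
  | succ n ih =>
    simp only [zeros, cost_cons, spaceLabel_left, nextPointer_zero, add_zero, Nat.zero_sub, ih,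
      weight]
    ring

/-- The diagram of `seesaw l (n + 2)`, multiplied by a power of `x 0` such that the pointer of the
second forest is at its tree number `c + 1`. -/
def seesawDiagram (n l c : ℕ) : Diagram :=
  (n + 1, c) :: (1, 0) :: zeros (n + 1) (caretRow l)

/-- The caret of the first forest at leaf 1 blocks every cancellation at leaf 0, wherever the
pointers are. -/
lemma reduce_cons_one_zero {t : Diagram} (ht : IsReduced t) (a b : ℕ) :
    reduce ((a, b) :: (1, 0) :: t) = (a, b) :: (1, 0) :: t := by
  rw [reduce, (ht.cons (Or.inr rfl)).2]
  rcases a with _ | a <;> rcases b with _ | b <;> simp [push]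

lemma size_cons_one_zero (a b : ℕ) (t : Diagram) :
    size ((a, b) :: (1, 0) :: t) = 3 + cost 1 a 0 b t := size_eq _

lemma size_seesawDiagram (n : ℕ) {l : ℕ} (hl : 1 ≤ l) :
    size (seesawDiagram n l (n + 2)) = 2 * n + 3 * l + 10 := by
  rw [seesawDiagram, size_cons_one_zero, zeros, cost_cons, spaceLabel_left]
  have := cost_zeros_caretRow n hl
  simp only [nextPointer_zero, Nat.sub_self, add_zero, Nat.zero_sub,
    show nextPointer 1 (n + 1) = n + 1 from rfl, show spaceLabel 1 (n + 1) 0 = .inner from rfl,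
    weight, this]
  ring

lemma size_seesawDiagram_le (n l c i : ℕ) :
    size (seesawDiagram n l (c + i)) ≤ size (seesawDiagram n l c) + i ∧
      size (seesawDiagram n l c) ≤ size (seesawDiagram n l (c + i)) + i := by
  induction i with
  | zero => exact ⟨le_rfl, le_rfl⟩
  | succ i ih =>
    have := cost_pointer (zeros (n + 1) (caretRow l)) 1 (n + 1) 0 (c + i)
    simp only [seesawDiagram, size_cons_one_zero, ← add_assoc] at ih ⊢
    omega

lemma size_addCaret_seesawDiagram {n l c : ℕ} (h : c < n + 1 + l) :
    size (reduce (addCaret 1 (seesawDiagram n l (c + 1)))) =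
      size (seesawDiagram n l (c + 1)) + 1 := by
  rw [seesawDiagram, addCaret, zero_add, addCaret, add_zero, zeros]
  suffices cost 1 (n + 1) 0 (c + 1) (addCaret c ((0, 0) :: zeros n (caretRow l))) =
      cost 1 (n + 1) 0 (c + 1) ((0, 0) :: zeros n (caretRow l)) + 1 ∧
      IsReduced (addCaret c ((0, 0) :: zeros n (caretRow l))) by
    rw [reduce_cons_one_zero this.2, size_cons_one_zero, size_cons_one_zero, this.1, add_assoc]
  rcases c with _ | c
  · exact ⟨cost_addCaret_zero_cons le_rfl rfl _,
      by rw [addCaret]; exact ((isReduced_caretRow l).zeros n).cons (Or.inl rfl)⟩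
  · obtain ⟨h₁, h₂⟩ := cost_addCaret_zeros (c := c) (n := n) (l := l) (by omega)
    rw [addCaret]
    exact ⟨cost_zero_cons_add_one h₁, h₂.cons (Or.inl rfl)⟩

lemma size_removeCaret_seesawDiagram {n l c : ℕ} (h : c < n + 1 + l) :
    size (reduce (removeCaret 1 (seesawDiagram n l (c + 1)))) =
      size (seesawDiagram n l (c + 1)) + 1 := by
  rw [seesawDiagram, removeCaret, zero_add, removeCaret, add_zero, zeros]
  suffices cost 1 (n + 1) 0 (c + 1) (removeCaret c ((0, 0) :: zeros n (caretRow l))) =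
      cost 1 (n + 1) 0 (c + 1) ((0, 0) :: zeros n (caretRow l)) + 1 ∧
      IsReduced (removeCaret c ((0, 0) :: zeros n (caretRow l))) by
    rw [reduce_cons_one_zero this.2, size_cons_one_zero, size_cons_one_zero, this.1, add_assoc]
  rcases c with _ | c
  · rw [removeCaret]
    exact ⟨cost_split _ _ _ _,
      (((isReduced_caretRow l).zeros n).cons (Or.inl rfl)).cons (Or.inr rfl)⟩
  · obtain ⟨h₁, h₂⟩ := cost_removeCaret_zeros (c := c) (n := n) (l := l) (by omega)
    rw [removeCaret]
    exact ⟨cost_zero_cons_add_one h₁, h₂.cons (Or.inl rfl)⟩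

lemma diagram_x_zero_pow (k : ℕ) :
    diagram (x 0 ^ k) = Quotient.mk diagramSetoid [(k, 0)] := by
  induction k with
  | zero =>
    rw [pow_zero, diagram_one]
    exact Quotient.sound rfl
  | succ k ih =>
    rw [pow_succ, diagram_mul_x_of_eq ih, removeCaret]
    refine Quotient.sound ?_
    change reduce _ = reduce _
    simp [reduce, push]

lemma diagram_mul_x_zero_inv_pow {f : ThompsonF} {a b : ℕ} {t : Diagram}
    (h : diagram f = Quotient.mk diagramSetoid ((a, b) :: t)) (i : ℕ) :
    diagram (f * (x 0)⁻¹ ^ i) = Quotient.mk diagramSetoid ((a, b + i) :: t) := by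
  induction i with
  | zero => simpa using h
  | succ i ih => rw [pow_succ, ← mul_assoc, diagram_mul_x_inv_of_eq ih, addCaret]; rfl

lemma diagram_mul_x_zero_pow {f : ThompsonF} {a b : ℕ} {t : Diagram} (i : ℕ)
    (h : diagram f = Quotient.mk diagramSetoid ((a, b + i) :: t)) :
    diagram (f * x 0 ^ i) = Quotient.mk diagramSetoid ((a, b) :: t) := by
  induction i generalizing f with
  | zero => simpa using h
  | succ i ih =>
    rw [pow_succ', ← mul_assoc]
    apply ih
    rw [diagram_mul_x_of_eq h, ← add_assoc, removeCaret]

lemma diagram_mul_prod {f : ThompsonF} {a n i j : ℕ}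
    (h : diagram f = Quotient.mk diagramSetoid
      ((a, 0) :: (1, 0) :: zeros (n + 1 + 2 * j) (caretRow i))) :
    diagram (f * ((List.range j).reverse.map fun i => (x (n + 2 + 2 * i + 1))⁻¹).prod) =
      Quotient.mk diagramSetoid ((a, 0) :: (1, 0) :: zeros (n + 1) (caretRow (i + j))) := by
  induction j generalizing f i with
  | zero => simpa using h
  | succ j ih =>
    rw [List.range_succ, List.reverse_append, List.reverse_singleton, List.singleton_append,
      List.map_cons, List.prod_cons, ← mul_assoc, ← add_assoc, add_right_comm i]
    apply ih
    rw [diagram_mul_x_inv_of_eq h, show n + 2 + 2 * j + 1 = n + 1 + 2 * j + 1 + 1 by ring,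
      show n + 1 + 2 * (j + 1) = n + 1 + 2 * j + 2 by ring, zeros_add _ 2, addCaret, add_zero,
      addCaret, add_zero]
    exact congrArg (fun t => Quotient.mk diagramSetoid ((a, 0) :: (1, 0) :: t))
      ((addCaret_zeros (n + 1 + 2 * j) 0 _).trans (by simp only [zeros, addCaret]; rfl))

lemma diagram_seesaw (n l : ℕ) :
    diagram (seesaw l (n + 2)) = Quotient.mk diagramSetoid (seesawDiagram n l (n + 2)) := by
  rw [seesaw, ← inv_pow]
  have h : diagram (x 0 ^ (n + 1) * x 1 * x (n + 2 + 2 * l + 2)) = Quotient.mk diagramSetoid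
      ((n + 1, 0) :: (1, 0) :: zeros (n + 2 + 2 * l) [(1, 0)]) := by
    rw [diagram_mul_x_of_eq (diagram_mul_x_of_eq (diagram_x_zero_pow _) 1) _]
    simp only [removeCaret, removeCaret_nil, zeros, add_zero]
  have h' := diagram_mul_x_inv_of_eq h (n + 2 + 2 * l + 1)
  rw [show n + 2 + 2 * l + 1 = n + 1 + 2 * l + 1 + 1 by ring,
    show n + 2 + 2 * l = n + 1 + 2 * l + 1 by ring, zeros_add _ 1, addCaret, add_zero,
    addCaret, add_zero] at h'
  have h₀ : addCaret (n + 1 + 2 * l) (zeros (n + 1 + 2 * l) (zeros 1 [(1, 0)])) =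
      zeros (n + 1 + 2 * l) (caretRow 0) :=
    (addCaret_zeros (n + 1 + 2 * l) 0 _).trans (by simp only [zeros, addCaret]; rfl)
  rw [h₀] at h'
  have := diagram_mul_x_zero_inv_pow (diagram_mul_prod h') (n + 2)
  rw [zero_add, zero_add] at this
  rw [List.range_succ, List.reverse_append, List.reverse_singleton, List.singleton_append,
    List.map_cons, List.prod_cons, ← mul_assoc]
  rw [show n + 2 + 2 * l + 2 = n + 1 + 2 * l + 1 + 2 by ring,
    show n + 2 + 2 * l + 1 = n + 1 + 2 * l + 1 + 1 by ring]
  exact this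

/-! ### Short words for the ends of the seesaw -/

/-- The middle part of a seesaw word. -/
def core (l s : ℕ) : ThompsonF :=
  x (s + 2 * l + 2) * ((List.range (l + 1)).reverse.map fun i => (x (s + 2 * i + 1))⁻¹).prod

lemma seesaw_eq (l m : ℕ) : seesaw l m = x 0 ^ (m - 1) * x 1 * core l m * (x 0 ^ m)⁻¹ := by
  rw [seesaw, core]
  group

lemma x_inv_mul_x {i j : ℕ} (h : i < j) : (x j)⁻¹ * x i = x i * (x (j + 1))⁻¹ := by
  rw [inv_mul_eq_iff_eq_mul, ← mul_assoc, x_mul_x h, mul_inv_cancel_right]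

lemma prod_mul_x {i s : ℕ} (h : i ≤ s) (L : List ℕ) :
    (L.map fun k => (x (s + 2 * k + 1))⁻¹).prod * x i =
      x i * (L.map fun k => (x (s + 1 + 2 * k + 1))⁻¹).prod := by
  induction L with
  | nil => simp
  | cons k L ih =>
    rw [List.map_cons, List.prod_cons, mul_assoc, ih, ← mul_assoc, x_inv_mul_x (by omega),
      mul_assoc, List.map_cons, List.prod_cons, show s + 2 * k + 1 + 1 = s + 1 + 2 * k + 1 by ring]

lemma core_mul_x {i s : ℕ} (h : i ≤ s) (l : ℕ) : core l s * x i = x i * core l (s + 1) := by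
  rw [core, mul_assoc, prod_mul_x h, ← mul_assoc, x_mul_x (by omega), mul_assoc, core,
    show s + 2 * l + 2 + 1 = s + 1 + 2 * l + 2 by ring]

lemma core_mul_x_zero_pow (l s k : ℕ) : core l s * x 0 ^ k = x 0 ^ k * core l (s + k) := by
  induction k with
  | zero => simp
  | succ k ih =>
    rw [pow_succ, ← mul_assoc, ih, mul_assoc, core_mul_x (Nat.zero_le _), ← mul_assoc, add_assoc]

lemma core_succ (l s : ℕ) : core (l + 1) s = core l (s + 2) * (x (s + 1))⁻¹ := by
  rw [core, core, List.range_succ_eq_map, List.reverse_cons, List.map_append, List.prod_append,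
    ← mul_assoc, ← List.map_reverse, List.map_map]
  congr 2
  · congr 1; ring
  · congr 2
    ext i
    simp only [Function.comp, Nat.succ_eq_add_one]
    congr 2; ring

/-- Moving the last factor of `core (l + 1) 0` to the front and conjugating by `x 0` gives `core (l
+ 1) 0 = (x 1)⁻¹ * (x 0)⁻¹ * core l 0 * x 0`. -/
lemma core_zero_eq (l : ℕ) :
    core l 0 = ((x 1)⁻¹ * (x 0)⁻¹) ^ l * ((x 0)⁻¹ * x 1 * x 0 * (x 1)⁻¹) * x 0 ^ l := by
  induction l with
  | zero =>
    rw [mul_assoc (x 0)⁻¹, x_mul_x one_pos]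
    simp [core]
  | succ l ih =>
    have h : core (l + 1) 0 = (x 1)⁻¹ * core l 1 := by
      rw [core_succ, eq_inv_mul_iff_mul_eq, ← mul_assoc, ← core_mul_x le_rfl, mul_inv_cancel_right]
    rw [h, ← inv_mul_eq_iff_eq_mul.2 (core_mul_x (Nat.zero_le 0) l), ih, pow_succ', pow_succ]
    simp only [mul_assoc]

/-- The factor `x 1` and the power of `x 0` pass to the right through `core`, which shifts its
indices down to `core l 0`. -/
lemma seesaw_mul_pow (l n : ℕ) :
    seesaw l (n + 2) * x 0 ^ (n + 2) = ((x 1)⁻¹ * (x 0)⁻¹) ^ l *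
      ((x 0)⁻¹ * x 1 * x 0 * (x 1)⁻¹) * x 0 ^ (l + (n + 1)) * x 1 := by
  rw [seesaw_eq, inv_mul_cancel_right, pow_add, ← mul_assoc _ (x 0 ^ l), ← core_zero_eq,
    core_mul_x_zero_pow, mul_assoc _ _ (x 1), zero_add, core_mul_x (by omega), ← mul_assoc]
  rfl

/-- Here `core l (n + 2)` is the conjugate of `core l 0` by `x 0 ^ (n + 2)`, and the power `x 0 ^ l`
that ends `core l 0` cancels. -/
lemma seesaw_mul_inv_pow (l n : ℕ) :
    seesaw l (n + 2) * (x 0)⁻¹ ^ l = x 0 ^ (n + 1) * x 1 * (x 0)⁻¹ ^ (n + 2) *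
      (((x 1)⁻¹ * (x 0)⁻¹) ^ l * ((x 0)⁻¹ * x 1 * x 0 * (x 1)⁻¹)) := by
  have h := core_mul_x_zero_pow l 0 (n + 2)
  rw [zero_add, ← inv_mul_eq_iff_eq_mul] at h
  rw [inv_pow, mul_inv_eq_iff_eq_mul, mul_assoc, ← core_zero_eq, seesaw_eq, ← h, inv_pow]
  simp only [mul_assoc, mul_inv_cancel, mul_one]
  rfl

lemma wordLength_core_le (l : ℕ) :
    wordLength stdGens (((x 1)⁻¹ * (x 0)⁻¹) ^ l * ((x 0)⁻¹ * x 1 * x 0 * (x 1)⁻¹)) ≤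
      2 * l + 4 := by
  have hm := wordLength_mul_le closure_stdGens
  have h₀ := wordLength_le_one (Or.inl x_zero_mem)
  have h₁ := wordLength_le_one (Or.inl x_one_mem)
  have h₀' := wordLength_le_one (X := stdGens) (g := (x 0)⁻¹) (Or.inr (by simpa using x_zero_mem))
  have h₁' := wordLength_le_one (X := stdGens) (g := (x 1)⁻¹) (Or.inr (by simpa using x_one_mem))
  have h₂ := wordLength_pow_le closure_stdGens ((x 1)⁻¹ * (x 0)⁻¹) l
  have h₃ := Nat.mul_le_mul_left l ((hm (x 1)⁻¹ (x 0)⁻¹).trans (add_le_add h₁' h₀'))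
  have h₄ := hm (((x 1)⁻¹ * (x 0)⁻¹) ^ l) ((x 0)⁻¹ * x 1 * x 0 * (x 1)⁻¹)
  have h₅ := hm ((x 0)⁻¹ * x 1 * x 0) (x 1)⁻¹
  have h₆ := hm ((x 0)⁻¹ * x 1) (x 0)
  have h₇ := hm (x 0)⁻¹ (x 1)
  omega

lemma wordLength_seesaw_mul_pow_le (l n : ℕ) :
    wordLength stdGens (seesaw l (n + 2) * x 0 ^ (n + 2)) ≤ n + 3 * l + 6 := by
  have hm := wordLength_mul_le closure_stdGens
  have h₁ := wordLength_le_one (Or.inl x_one_mem)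
  have h₂ := wordLength_generator_pow_le closure_stdGens (Or.inl x_zero_mem) (l + (n + 1))
  have h₃ := wordLength_core_le l
  rw [seesaw_mul_pow]
  refine (hm _ _).trans ?_
  have := hm (((x 1)⁻¹ * (x 0)⁻¹) ^ l * ((x 0)⁻¹ * x 1 * x 0 * (x 1)⁻¹)) (x 0 ^ (l + (n + 1)))
  omega

lemma wordLength_seesaw_mul_inv_pow_le (l n : ℕ) :
    wordLength stdGens (seesaw l (n + 2) * (x 0)⁻¹ ^ l) ≤ 2 * n + 2 * l + 8 := by
  have hm := wordLength_mul_le closure_stdGens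
  have h₁ := wordLength_le_one (Or.inl x_one_mem)
  have h₂ := wordLength_generator_pow_le closure_stdGens (Or.inl x_zero_mem) (n + 1)
  have h₃ := wordLength_generator_pow_le (X := stdGens) (g := (x 0)⁻¹) closure_stdGens
    (Or.inr (by simpa using x_zero_mem)) (n + 2)
  have h₄ := wordLength_core_le l
  rw [seesaw_mul_inv_pow]
  refine (hm _ _).trans ?_
  have h₅ := hm (x 0 ^ (n + 1) * x 1) ((x 0)⁻¹ ^ (n + 2))
  have h₆ := hm (x 0 ^ (n + 1)) (x 1)
  omega

/-! ### Seesaw words -/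

lemma le_wordLength_of_diagram {f : ThompsonF} {n l c : ℕ}
    (h : diagram f = Quotient.mk diagramSetoid (seesawDiagram n l (c + 1))) (hc : c < n + 1 + l) :
    size (seesawDiagram n l (c + 1)) ≤ wordLength stdGens (f * x 1) + 1 ∧
      size (seesawDiagram n l (c + 1)) ≤ wordLength stdGens (f * (x 1)⁻¹) + 1 := by
  have h₁ := reducedSize_diagram_le (f * x 1)
  have h₂ := reducedSize_diagram_le (f * (x 1)⁻¹)
  rw [diagram_mul_x_of_eq h, reducedSize_mk, size_removeCaret_seesawDiagram hc] at h₁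
  rw [diagram_mul_x_inv_of_eq h, reducedSize_mk, size_addCaret_seesawDiagram hc] at h₂
  omega

lemma wordLength_seesaw (n : ℕ) {l : ℕ} (hl : 1 ≤ l) :
    wordLength stdGens (seesaw l (n + 2)) = 2 * n + 3 * l + 8 := by
  apply le_antisymm
  · have h₁ := wordLength_mul_le closure_stdGens (seesaw l (n + 2) * (x 0)⁻¹ ^ l) (x 0 ^ l)
    have h₂ := wordLength_generator_pow_le closure_stdGens (Or.inl x_zero_mem) l
    have h₃ := wordLength_seesaw_mul_inv_pow_le l n
    rw [inv_pow] at h₁ h₃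
    rw [inv_mul_cancel_right] at h₁
    omega
  · have h := reducedSize_diagram_le (seesaw l (n + 2))
    rw [diagram_seesaw, reducedSize_mk, seesawDiagram,
      reduce_cons_one_zero ((isReduced_caretRow l).zeros (n + 1)), ← seesawDiagram,
      size_seesawDiagram n hl] at h
    omega

lemma wordLength_seesaw_forward {n l i : ℕ} (hl : 1 ≤ l) (hi : i ≤ n + 2) :
    wordLength stdGens (seesaw l (n + 2) * x 0 ^ i) + i = 2 * n + 3 * l + 8 := by
  have h₁ := wordLength_seesaw n hl
  have h₂ := wordLength_seesaw_mul_pow_le l n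
  rw [← h₁]
  exact wordLength_mul_pow closure_stdGens (Or.inl x_zero_mem) (n := n + 2) (by omega) hi

lemma wordLength_seesaw_backward {n l i : ℕ} (hl : 1 ≤ l) (hi : i ≤ l) :
    wordLength stdGens (seesaw l (n + 2) * (x 0)⁻¹ ^ i) + i = 2 * n + 3 * l + 8 := by
  have h₁ := wordLength_seesaw n hl
  have h₂ := wordLength_seesaw_mul_inv_pow_le l n
  rw [← h₁]
  exact wordLength_mul_pow closure_stdGens (Or.inr (by simpa using x_zero_mem)) (n := l)
    (by omega) hi

/-- After `i` pointer moves the size has dropped by at most `i`, and the caret move then raises it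
by one. -/
lemma le_wordLength_seesaw_forward {n l i : ℕ} (hl : 1 ≤ l) (hi : i < n + 2) :
    2 * n + 3 * l + 9 ≤ wordLength stdGens (seesaw l (n + 2) * x 0 ^ i * x 1) + i ∧
      2 * n + 3 * l + 9 ≤ wordLength stdGens (seesaw l (n + 2) * x 0 ^ i * (x 1)⁻¹) + i := by
  obtain ⟨c, hc⟩ := Nat.exists_eq_add_of_lt hi
  have hd := diagram_seesaw n l
  have hs := size_seesawDiagram n hl
  rw [show n + 2 = c + 1 + i by omega] at hd hs
  have h₁ := le_wordLength_of_diagram (diagram_mul_x_zero_pow i hd) (by omega)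
  have h₂ := size_seesawDiagram_le n l (c + 1) i
  rw [show c + 1 + i = n + 2 by omega] at *
  omega

lemma le_wordLength_seesaw_backward {n l i : ℕ} (hl : 1 ≤ l) (hi : i < l) :
    2 * n + 3 * l + 9 ≤ wordLength stdGens (seesaw l (n + 2) * (x 0)⁻¹ ^ i * x 1) + i ∧
      2 * n + 3 * l + 9 ≤
        wordLength stdGens (seesaw l (n + 2) * (x 0)⁻¹ ^ i * (x 1)⁻¹) + i := by
  have hs := size_seesawDiagram n hl
  have hd := diagram_mul_x_zero_inv_pow (diagram_seesaw n l) i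
  have h₂ := size_seesawDiagram_le n l (n + 2) i
  rw [show n + 2 + i = n + 1 + i + 1 by ring] at hd h₂
  have h₁ := le_wordLength_of_diagram hd (by omega)
  omega

lemma isSeesawWord_seesaw {k l n : ℕ} (hl : 1 ≤ l) (hkl : k ≤ l) (hkn : k ≤ n + 2) :
    IsSeesawWord stdGens (x 0) (seesaw l (n + 2)) k where
  finite := (Set.finite_singleton _).insert _
  generates := closure_stdGens
  mem := x_zero_mem
  shorten := by
    have h₁ := wordLength_seesaw n hl
    have h₂ := wordLength_seesaw_forward (n := n) (i := 1) hl (by omega)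
    rw [pow_one] at h₂
    omega
  shorten_inv := by
    have h₁ := wordLength_seesaw n hl
    have h₂ := wordLength_seesaw_backward (n := n) (i := 1) hl hl
    rw [pow_one] at h₂
    omega
  others := by
    rintro h (rfl | rfl) h₁ -
    · exact absurd rfl h₁
    · have h₁ := wordLength_seesaw n hl
      have h₂ := le_wordLength_seesaw_forward (n := n) (i := 0) hl (by omega)
      rw [pow_zero, mul_one] at h₂
      omega
  forward i hi := by
    have h₁ := wordLength_seesaw_forward (n := n) (i := i) hl (by omega)
    have h₂ := wordLength_seesaw_forward (n := n) (i := i + 1) hl (by omega)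
    omega
  forward_others i hi hik h hX hne := by
    have h₁ := wordLength_seesaw_forward (n := n) (i := i) hl (by omega)
    have h₂ := le_wordLength_seesaw_forward (n := n) (i := i) hl (by omega)
    rcases hX with (rfl | rfl) | (hX | hX)
    · exact absurd rfl hne
    · omega
    -- The letter undoes the last step, so the length rises by one.
    · obtain rfl := inv_eq_iff_eq_inv.1 hX
      obtain ⟨j, rfl⟩ := Nat.exists_eq_add_of_le' hi
      have h₃ := wordLength_seesaw_forward (n := n) (i := j) hl (by omega)
      rw [pow_succ, ← mul_assoc, mul_inv_cancel_right]
      rw [pow_succ, ← mul_assoc] at h₁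
      omega
    · obtain rfl := inv_eq_iff_eq_inv.1 hX
      omega
  backward i hi := by
    have h₁ := wordLength_seesaw_backward (n := n) (i := i) hl (by omega)
    have h₂ := wordLength_seesaw_backward (n := n) (i := i + 1) hl (by omega)
    omega
  backward_others i hi hik h hX hne := by
    have h₁ := wordLength_seesaw_backward (n := n) (i := i) hl (by omega)
    have h₂ := le_wordLength_seesaw_backward (n := n) (i := i) hl (by omega)
    rcases hX with (rfl | rfl) | (hX | hX)
    · obtain ⟨j, rfl⟩ := Nat.exists_eq_add_of_le' hi
      have h₃ := wordLength_seesaw_backward (n := n) (i := j) hl (by omega)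
      rw [pow_succ, ← mul_assoc, inv_mul_cancel_right]
      rw [pow_succ, ← mul_assoc] at h₁
      omega
    · omega
    · exact absurd (inv_eq_iff_eq_inv.1 hX) hne
    · obtain rfl := inv_eq_iff_eq_inv.1 hX
      omega

end ThompsonF

theorem theorem4p1 :
    (∀ k : ℕ, ∃ w : ThompsonF,
      IsSeesawWord ThompsonF.stdGens (ThompsonF.x 0) w k) ∧
    (∀ k l m : ℕ, 1 ≤ l → 2 ≤ m → k ≤ l → k ≤ m →
      IsSeesawWord ThompsonF.stdGens (ThompsonF.x 0) (ThompsonF.seesaw l m) k) := by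
  -- The shifts by 1 and 2 ensure `1 ≤ l` and `2 ≤ m` also for `k = 0`.
  refine ⟨fun k => ⟨ThompsonF.seesaw (k + 1) (k + 2), ?_⟩, fun k l m hl hm hkl hkm => ?_⟩
  · exact ThompsonF.isSeesawWord_seesaw (by omega) (by omega) (by omega)
  · obtain ⟨n, rfl⟩ := Nat.exists_eq_add_of_le' hm
    exact ThompsonF.isSeesawWord_seesaw hl hkl hkm
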